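/- **Diagonalization Lemma.** Let $T$ be a first-order theory with equality (given by an arbitrary set of proper axioms, with $\vdash$ denoting provability in $T$) in a language with a constant $0$ and a unary function symbol $S$. For $n\in\mathbb N$ let $\bar n$ be the numeral $S\cdots S0$ with $n$ occurrences of $S$. Fix a Gödel numbering, i.e. an injective map from well-formed formulas to $\mathbb N$, and, in formulas, write $\ulcorner \mathcal B\urcorner$ also for the numeral of the Gödel number of $\mathcal B$. Let $x$ be a variable and let $D:\mathbb N\to\mathbb N$ be a function such that $$D(\ulcorner \mathcal B(x)\urcorner)=\ulcorner \mathcal B(\ulcorner \mathcal B(x)\urcorner)\urcorner$$ for every formula $\mathcal B(x)$ whose only free variable is $x$. Assume that $D$ is representable in $T$, i.e. there is a formula $\delta(u,y)$ with no free variables other than $u,y$ such that $\vdash(\forall y)\,(\delta(\bar n,y)\leftrightarrow y=\overline{D(n)})$ for every $n\in\mathbb N$. (This is the case, in particular, if $D$ is recursive and every recursive function is representable in $T$.) Then for every formula $\mathcal E(x)$ whose only free variable is $x$ there is a closed formula $\mathcal C$ such that $$\vdash\ \mathcal C\leftrightarrow\mathcal E(\ulcorner\mathcal C\urcorner).$$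 -/

import Mathlib

open FirstOrder FirstOrder.Language

namespace DiagLemma

universe u v

variable {L : FirstOrder.Language.{u, v}}

/-- Well-formed formulas of `L`, with free variables named by natural numbers
(bound variables are nameless, so formulas are taken up to renaming of bound variables). -/
abbrev Wf (L : FirstOrder.Language.{u, v}) : Type (max u v) := L.Formula ℕ

/-- The term `x`, for a variable `x`. -/
abbrev vr (x : ℕ) : L.Term ℕ := Term.var x

/-- `φ(t)`: the (capture-free) substitution of the term `t` for the free variable `x` in `φ`. -/
def substVar (φ : Wf L) (x : ℕ) (t : L.Term ℕ) : Wf L :=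
  φ.subst (fun y => if y = x then t else vr y)

/-- `(∀ x) φ`: binds the variable `x` in `φ`. -/
def allVar (x : ℕ) (φ : Wf L) : Wf L :=
  BoundedFormula.all (n := 0)
    (BoundedFormula.relabel (n := 1) (k := 0)
      (fun y => if y = x then Sum.inr (0 : Fin 1) else Sum.inl y) φ)

/-- `⊢ φ`: provability of `φ` in the first-order theory with equality whose proper axioms
are the members of `T` (Hilbert-style calculus with modus ponens and generalization). -/
inductive Provable (T : Set (Wf L)) : Wf L → Prop
  | proper {φ : Wf L} (h : φ ∈ T) : Provable T φ
  | a1 (φ ψ : Wf L) : Provable T (φ.imp (ψ.imp φ))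
  | a2 (φ ψ χ : Wf L) :
      Provable T ((φ.imp (ψ.imp χ)).imp ((φ.imp ψ).imp (φ.imp χ)))
  | a3 (φ ψ : Wf L) :
      Provable T ((ψ.not.imp φ.not).imp ((ψ.not.imp φ).imp ψ))
  | a4 (x : ℕ) (φ : Wf L) (t : L.Term ℕ) :
      Provable T ((allVar x φ).imp (substVar φ x t))
  | a5 (x : ℕ) (φ ψ : Wf L) (h : x ∉ φ.freeVarFinset) :
      Provable T ((allVar x (φ.imp ψ)).imp (φ.imp (allVar x ψ)))
  | a6 (t : L.Term ℕ) : Provable T (t.equal t)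
  | a7 (x : ℕ) (φ : Wf L) (t s : L.Term ℕ) :
      Provable T ((t.equal s).imp ((substVar φ x t).imp (substVar φ x s)))
  | mp {φ ψ : Wf L} (h₁ : Provable T (φ.imp ψ)) (h₂ : Provable T φ) : Provable T ψ
  | gen (x : ℕ) {φ : Wf L} (h : Provable T φ) : Provable T (allVar x φ)

/-- The numeral of `n`: the term `S(S(⋯S(0)⋯))` with `n` occurrences of `S`. -/
def numeral (zero : L.Functions 0) (succ : L.Functions 1) : ℕ → L.Term ℕ
  | 0 => Term.func zero Fin.elim0
  | n + 1 => Term.func succ ![numeral zero succ n]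

/-- `⌜φ⌝` as a term of the language: the numeral of the Gödel number of `φ`. -/
def quote (zero : L.Functions 0) (succ : L.Functions 1) (gn : Wf L ↪ ℕ) (φ : Wf L) :
    L.Term ℕ :=
  numeral zero succ (gn φ)

/-- `D` is a diagonal function for the variable `x`: `D(⌜B(x)⌝) = ⌜B(⌜B(x)⌝)⌝` for every
formula `B` whose only free variable is `x`. -/
def IsDiagonal (zero : L.Functions 0) (succ : L.Functions 1) (gn : Wf L ↪ ℕ)
    (x : ℕ) (D : ℕ → ℕ) : Prop :=
  ∀ B : Wf L, B.freeVarFinset = {x} →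
    D (gn B) = gn (substVar B x (quote zero succ gn B))

/-- The function `f` is representable in the theory `T`: there is a formula `δ` with two free
variables such that `⊢ (∀ y) (δ(n, y) ↔ y = f(n))` for every number `n`, where `n` and `f(n)`
stand for numerals. -/
def Representable (T : Set (Wf L)) (zero : L.Functions 0) (succ : L.Functions 1)
    (f : ℕ → ℕ) : Prop :=
  ∃ δ : L.Formula (Fin 2), ∀ n : ℕ,
    Provable T (allVar 0
      (BoundedFormula.iff (δ.subst ![numeral zero succ n, vr 0])
        ((vr 0).equal (numeral zero succ (f n)))))

end DiagLemma

/-! Let B(x) be ∀y (δ(x,y) → E(y)), which says that E holds of the D-value of x. Put b = ⌜B⌝, C =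
B(b) and q = ⌜C⌝. Diagonality gives D(b) = q, so δ(b,y) is provably equivalent to y = q, and C
collapses to E(q): instantiate y by q in one direction; use substitutivity of equality, then
generalize, in the other. The remaining work is syntactic: `relabel_subst` moves substitutions under
quantifiers, `mem_freeVarFinset_subst` bounds free variables, and a little propositional logic is
derived from `a1`–`a3`. -/

namespace DiagLemma

universe u' v' w'

/-! ### Substitution, relabelling and free variables. -/

section Substitution

variable {L : FirstOrder.Language.{u', v'}} {α β γ : Type w'}

theorem term_subst_subst (t : L.Term α) (f : α → L.Term β) (g : β → L.Term γ) :
    (t.subst f).subst g = t.subst fun a => (f a).subst g := by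
  induction t with
  | var a => rfl
  | func F ts ih => simp only [Term.subst, ih]

theorem term_relabel_subst (t : L.Term α) (f : α → β) (g : β → L.Term γ) :
    (t.relabel f).subst g = t.subst (g ∘ f) := by
  induction t with
  | var a => rfl
  | func F ts ih => simp only [Term.relabel, Term.subst, ih]

theorem term_subst_relabel (t : L.Term α) (f : α → L.Term β) (g : β → γ) :
    (t.subst f).relabel g = t.subst fun a => (f a).relabel g := by
  induction t with
  | var a => rfl
  | func F ts ih => simp only [Term.relabel, Term.subst, ih]

theorem term_subst_var (t : L.Term α) : t.subst Term.var = t := by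
  induction t with
  | var a => rfl
  | func F ts ih => simp only [Term.subst, ih]

theorem term_relabel_eq_subst (t : L.Term α) (f : α → β) :
    t.relabel f = t.subst (Term.var ∘ f) := by
  rw [← term_subst_var (t.relabel f), term_relabel_subst]

/-- The extension of a substitution to terms with bound variables. -/
def liftSubst (f : α → L.Term β) (k : ℕ) : α ⊕ Fin k → L.Term (β ⊕ Fin k) :=
  Sum.elim (Term.relabel Sum.inl ∘ f) (Term.var ∘ Sum.inr)

theorem term_subst_congr_left [DecidableEq α] {k : ℕ} (t : L.Term (α ⊕ Fin k))
    {f g : α → L.Term β} (h : ∀ a ∈ t.varFinsetLeft, f a = g a) :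
    t.subst (liftSubst f k) = t.subst (liftSubst g k) := by
  induction t with
  | var a =>
    rcases a with a | i
    · simp [Term.subst, liftSubst, h a (by simp [Term.varFinsetLeft])]
    · rfl
  | func F ts ih =>
    simp only [Term.subst]
    congr 1
    funext i
    refine ih i fun a ha => h a ?_
    simp only [Term.varFinsetLeft, Finset.mem_biUnion, Finset.mem_univ, true_and]
    exact ⟨i, ha⟩

theorem subst_congr [DecidableEq α] {k : ℕ} (φ : L.BoundedFormula α k)
    {f g : α → L.Term β} (h : ∀ a ∈ φ.freeVarFinset, f a = g a) :
    φ.subst f = φ.subst g := by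
  induction φ with
  | falsum => rfl
  | equal t₁ t₂ =>
    simp only [BoundedFormula.freeVarFinset, Finset.mem_union] at h
    exact congrArg₂ BoundedFormula.equal
      (term_subst_congr_left t₁ fun a ha => h a (.inl ha))
      (term_subst_congr_left t₂ fun a ha => h a (.inr ha))
  | rel R ts =>
    simp only [BoundedFormula.freeVarFinset, Finset.mem_biUnion, Finset.mem_univ, true_and] at h
    exact congrArg (BoundedFormula.rel R)
      (funext fun i => term_subst_congr_left (ts i) fun a ha => h a ⟨i, ha⟩)
  | imp φ ψ ihφ ihψ =>
    simp only [BoundedFormula.freeVarFinset, Finset.mem_union] at h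
    exact congrArg₂ BoundedFormula.imp (ihφ fun a ha => h a (.inl ha))
      (ihψ fun a ha => h a (.inr ha))
  | all φ ih => exact congrArg BoundedFormula.all (ih h)

theorem liftSubst_subst (f : α → L.Term β) (g : β → L.Term γ) (k : ℕ) (t : L.Term (α ⊕ Fin k)) :
    (t.subst (liftSubst f k)).subst (liftSubst g k) =
      t.subst (liftSubst (fun a => (f a).subst g) k) := by
  rw [term_subst_subst]
  congr 1
  funext a
  rcases a with a | i
  · simp only [liftSubst, Sum.elim_inl, Function.comp_apply, term_relabel_subst,
      term_subst_relabel]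
    rfl
  · rfl

theorem subst_subst {k : ℕ} (φ : L.BoundedFormula α k) (f : α → L.Term β) (g : β → L.Term γ) :
    (φ.subst f).subst g = φ.subst fun a => (f a).subst g := by
  induction φ with
  | falsum => rfl
  | equal t₁ t₂ =>
    exact congrArg₂ BoundedFormula.equal (liftSubst_subst f g _ t₁) (liftSubst_subst f g _ t₂)
  | rel R ts =>
    exact congrArg (BoundedFormula.rel R) (funext fun i => liftSubst_subst f g _ (ts i))
  | imp φ ψ ihφ ihψ => exact congrArg₂ BoundedFormula.imp ihφ ihψ
  | all φ ih => exact congrArg BoundedFormula.all ih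

theorem term_relabelAux_subst {n : ℕ} (g : α → β ⊕ Fin n) (g' : α → β ⊕ Fin n)
    (f : β → L.Term β) (f' : α → L.Term α)
    (h : ∀ a, (Term.var (g a) : L.Term (β ⊕ Fin n)).subst (liftSubst f n) = (f' a).relabel g')
    (k : ℕ) (t : L.Term (α ⊕ Fin k)) :
    (t.relabel (BoundedFormula.relabelAux g k)).subst (liftSubst f (n + k)) =
      (t.subst (liftSubst f' k)).relabel (BoundedFormula.relabelAux g' k) := by
  rw [term_relabel_subst, term_subst_relabel]
  congr 1
  funext a
  rcases a with a | i
  · have h2 := congrArg (Term.relabel (Sum.map id (Fin.castAdd k))) (h a)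
    simp only [Term.subst, Term.relabel_relabel] at h2
    simp only [liftSubst, Sum.elim_inl, Function.comp_apply, Term.relabel_relabel]
    have e : BoundedFormula.relabelAux g' k ∘ Sum.inl = Sum.map id (Fin.castAdd k) ∘ g' := by
      funext b
      simp only [BoundedFormula.relabelAux, Function.comp_apply, Sum.map_inl]
      rcases g' b with c | c <;> simp
    rw [e, ← h2]
    simp only [BoundedFormula.relabelAux, Function.comp_apply, Sum.map_inl]
    rcases g a with c | c
    · simp [liftSubst, Term.relabel_relabel]
      rfl
    · simp [liftSubst]
  · simp [liftSubst, BoundedFormula.relabelAux]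

/-- Since `allVar` binds by relabelling, this is what lets a substitution pass a quantifier.
Compatibility need only be checked on single variables. -/
theorem relabel_subst {n k : ℕ} (φ : L.BoundedFormula α k) (g : α → β ⊕ Fin n)
    (g' : α → β ⊕ Fin n) (f : β → L.Term β) (f' : α → L.Term α)
    (h : ∀ a, (Term.var (g a) : L.Term (β ⊕ Fin n)).subst (liftSubst f n) = (f' a).relabel g') :
    (φ.relabel g).subst f = (φ.subst f').relabel g' := by
  induction φ with
  | falsum => rfl
  | equal t₁ t₂ =>
    exact congrArg₂ BoundedFormula.equal (term_relabelAux_subst g g' f f' h _ t₁)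
      (term_relabelAux_subst g g' f f' h _ t₂)
  | rel R ts =>
    exact congrArg (BoundedFormula.rel R)
      (funext fun i => term_relabelAux_subst g g' f f' h _ (ts i))
  | imp φ ψ ihφ ihψ => exact congrArg₂ BoundedFormula.imp ihφ ihψ
  | all φ ih =>
    rw [BoundedFormula.relabel_all]
    change ((φ.relabel g).subst f).all = (φ.subst f').all.relabel g'
    rw [BoundedFormula.relabel_all, ih]

theorem mem_varFinsetLeft_subst [DecidableEq α] [DecidableEq β] {k : ℕ} (f : α → L.Term β)
    (t : L.Term (α ⊕ Fin k)) {b : β} (hb : b ∈ (t.subst (liftSubst f k)).varFinsetLeft) :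
    ∃ a ∈ t.varFinsetLeft, b ∈ (f a).varFinset := by
  induction t with
  | var a =>
    rcases a with a | i
    · refine ⟨a, by simp [Term.varFinsetLeft], ?_⟩
      simp only [Term.subst, liftSubst, Sum.elim_inl, Function.comp_apply] at hb
      generalize f a = s at hb
      induction s with
      | var c => simpa [Term.varFinsetLeft, Term.varFinset] using hb
      | func F ts ih =>
        simp only [Term.relabel, Term.varFinsetLeft, Term.varFinset, Finset.mem_biUnion,
          Finset.mem_univ, true_and] at hb ⊢
        exact hb.imp fun i hi => ih i hi
    · simp [Term.subst, liftSubst, Term.varFinsetLeft] at hb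
  | func F ts ih =>
    simp only [Term.subst, Term.varFinsetLeft, Finset.mem_biUnion, Finset.mem_univ,
      true_and] at hb ⊢
    obtain ⟨i, hi⟩ := hb
    obtain ⟨a, ha, hab⟩ := ih i hi
    exact ⟨a, ⟨i, ha⟩, hab⟩

theorem mem_freeVarFinset_subst [DecidableEq α] [DecidableEq β] {k : ℕ} (f : α → L.Term β)
    (φ : L.BoundedFormula α k) {b : β} (hb : b ∈ (φ.subst f).freeVarFinset) :
    ∃ a ∈ φ.freeVarFinset, b ∈ (f a).varFinset := by
  induction φ with
  | falsum => simp [BoundedFormula.subst, BoundedFormula.mapTermRel,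
      BoundedFormula.freeVarFinset] at hb
  | equal t₁ t₂ =>
    simp only [BoundedFormula.freeVarFinset, Finset.mem_union]
    rcases Finset.mem_union.1 hb with hb | hb
    · obtain ⟨a, ha, h⟩ := mem_varFinsetLeft_subst f t₁ hb
      exact ⟨a, .inl ha, h⟩
    · obtain ⟨a, ha, h⟩ := mem_varFinsetLeft_subst f t₂ hb
      exact ⟨a, .inr ha, h⟩
  | rel R ts =>
    obtain ⟨i, -, hi⟩ := Finset.mem_biUnion.1 hb
    obtain ⟨a, ha, h⟩ := mem_varFinsetLeft_subst f (ts i) hi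
    exact ⟨a, Finset.mem_biUnion.2 ⟨i, Finset.mem_univ i, ha⟩, h⟩
  | imp φ ψ ihφ ihψ =>
    simp only [BoundedFormula.freeVarFinset, Finset.mem_union]
    rcases Finset.mem_union.1 hb with hb | hb
    · obtain ⟨a, ha, h⟩ := ihφ hb
      exact ⟨a, .inl ha, h⟩
    · obtain ⟨a, ha, h⟩ := ihψ hb
      exact ⟨a, .inr ha, h⟩
  | all φ ih => exact ih hb

theorem mem_varFinsetLeft_relabelAux [DecidableEq α] [DecidableEq β] {n k : ℕ}
    (g : α → β ⊕ Fin n) (t : L.Term (α ⊕ Fin k)) {b : β}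
    (hb : b ∈ (t.relabel (BoundedFormula.relabelAux g k)).varFinsetLeft) :
    ∃ a ∈ t.varFinsetLeft, g a = Sum.inl b := by
  induction t with
  | var a =>
    rcases a with a | i
    · refine ⟨a, by simp [Term.varFinsetLeft], ?_⟩
      simp only [Term.relabel, BoundedFormula.relabelAux, Function.comp_apply, Sum.map_inl] at hb
      rcases hg : g a with c | c <;> simp_all [Term.varFinsetLeft]
    · simp [BoundedFormula.relabelAux, Term.varFinsetLeft] at hb
  | func F ts ih =>
    simp only [Term.relabel, Term.varFinsetLeft, Finset.mem_biUnion, Finset.mem_univ,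
      true_and] at hb ⊢
    obtain ⟨i, hi⟩ := hb
    obtain ⟨a, ha, hab⟩ := ih i hi
    exact ⟨a, ⟨i, ha⟩, hab⟩

theorem mem_freeVarFinset_relabel [DecidableEq α] [DecidableEq β] {n k : ℕ}
    (g : α → β ⊕ Fin n) (φ : L.BoundedFormula α k) {b : β}
    (hb : b ∈ (φ.relabel g).freeVarFinset) :
    ∃ a ∈ φ.freeVarFinset, g a = Sum.inl b := by
  induction φ with
  | falsum => simp [BoundedFormula.relabel, BoundedFormula.mapTermRel,
      BoundedFormula.freeVarFinset] at hb
  | equal t₁ t₂ =>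
    simp only [BoundedFormula.freeVarFinset, Finset.mem_union]
    rcases Finset.mem_union.1 hb with hb | hb
    · obtain ⟨a, ha, h⟩ := mem_varFinsetLeft_relabelAux g t₁ hb
      exact ⟨a, .inl ha, h⟩
    · obtain ⟨a, ha, h⟩ := mem_varFinsetLeft_relabelAux g t₂ hb
      exact ⟨a, .inr ha, h⟩
  | rel R ts =>
    obtain ⟨i, -, hi⟩ := Finset.mem_biUnion.1 hb
    obtain ⟨a, ha, h⟩ := mem_varFinsetLeft_relabelAux g (ts i) hi
    exact ⟨a, Finset.mem_biUnion.2 ⟨i, Finset.mem_univ i, ha⟩, h⟩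
  | imp φ ψ ihφ ihψ =>
    simp only [BoundedFormula.freeVarFinset, Finset.mem_union]
    rcases Finset.mem_union.1 hb with hb | hb
    · obtain ⟨a, ha, h⟩ := ihφ hb
      exact ⟨a, .inl ha, h⟩
    · obtain ⟨a, ha, h⟩ := ihψ hb
      exact ⟨a, .inr ha, h⟩
  | all φ ih =>
    rw [BoundedFormula.relabel_all] at hb
    exact ih hb

end Substitution

/-! ### Substitution of numerals and of terms for named variables. -/

section Wf

variable {L : FirstOrder.Language.{u', v'}}

theorem mem_freeVarFinset_allVar {x z : ℕ} {φ : Wf L}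
    (h : z ∈ (allVar x φ).freeVarFinset) : z ∈ φ.freeVarFinset ∧ z ≠ x := by
  obtain ⟨a, ha, hg⟩ := mem_freeVarFinset_relabel _ φ h
  split_ifs at hg with hax
  cases hg
  exact ⟨ha, hax⟩

theorem numeral_subst (zero : L.Functions 0) (succ : L.Functions 1) (n : ℕ)
    {β : Type} (f g : ℕ → L.Term β) :
    (numeral zero succ n).subst f = (numeral zero succ n).subst g := by
  induction n with
  | zero => simp only [numeral, Term.subst]; congr 1; funext i; exact i.elim0
  | succ n ih => simp [numeral, Term.subst, ih]

theorem numeral_subst_self (zero : L.Functions 0) (succ : L.Functions 1) (n : ℕ)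
    (f : ℕ → L.Term ℕ) : (numeral zero succ n).subst f = numeral zero succ n := by
  rw [numeral_subst zero succ n f Term.var, term_subst_var]

theorem varFinset_numeral (zero : L.Functions 0) (succ : L.Functions 1) (n : ℕ) :
    (numeral zero succ n).varFinset = ∅ := by
  induction n with
  | zero => simp [numeral, Term.varFinset]
  | succ n ih => simpa [numeral, Term.varFinset] using ih

/-- A numeral is closed, so `allVar y` has nothing in it to capture. -/
theorem substVar_allVar (zero : L.Functions 0) (succ : L.Functions 1) (n : ℕ) {x y : ℕ}
    (hxy : x ≠ y) (φ : Wf L) :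
    substVar (allVar y φ) x (numeral zero succ n) =
      allVar y (substVar φ x (numeral zero succ n)) := by
  refine congrArg (BoundedFormula.all (n := 0)) (relabel_subst φ _ _ _ _ fun a => ?_)
  by_cases hay : a = y
  · subst hay
    simp [liftSubst, Term.subst, hxy.symm]
  · by_cases hax : a = x
    · simp only [hax, hxy, if_false, if_true, Term.subst, liftSubst, Sum.elim_inl,
        Function.comp_apply]
      rw [term_relabel_eq_subst, term_relabel_eq_subst]
      exact numeral_subst zero succ n _ _
    · simp [liftSubst, Term.subst, hay, hax]

theorem substVar_substVar {φ : Wf L} {x : ℕ} (h : φ.freeVarFinset = {x}) (t : L.Term ℕ)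
    (z : ℕ) (s : L.Term ℕ) :
    substVar (substVar φ x t) z s =
      substVar φ x (t.subst fun y => if y = z then s else vr y) := by
  unfold substVar
  rw [subst_subst]
  refine subst_congr φ fun a ha => ?_
  rw [h, Finset.mem_singleton] at ha
  simp [ha]

theorem substVar_subst_pair (δ : L.Formula (Fin 2)) (t s r : L.Term ℕ) (z : ℕ) :
    substVar (δ.subst ![t, s]) z r =
      δ.subst ![t.subst fun y => if y = z then r else vr y,
        s.subst fun y => if y = z then r else vr y] := by
  unfold substVar
  rw [subst_subst]
  congr 1
  funext i
  fin_cases i <;> rfl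

theorem substVar_equal (t s r : L.Term ℕ) (z : ℕ) :
    substVar (t.equal s) z r =
      (t.subst fun y => if y = z then r else vr y).equal
        (s.subst fun y => if y = z then r else vr y) := by
  simp only [substVar, Term.equal, Term.bdEqual, BoundedFormula.subst, BoundedFormula.mapTermRel,
    term_relabel_subst, term_subst_relabel]
  rfl

theorem substVar_imp (φ ψ : Wf L) (z : ℕ) (r : L.Term ℕ) :
    substVar (φ.imp ψ) z r = (substVar φ z r).imp (substVar ψ z r) := rfl

theorem substVar_iff (φ ψ : Wf L) (z : ℕ) (r : L.Term ℕ) :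
    substVar (BoundedFormula.iff φ ψ) z r =
      BoundedFormula.iff (substVar φ z r) (substVar ψ z r) := rfl

theorem freeVarFinset_vr_equal (x : ℕ) :
    BoundedFormula.freeVarFinset ((vr x : L.Term ℕ).equal (vr x)) = {x} := by
  simp [Term.equal, Term.bdEqual, BoundedFormula.freeVarFinset, Term.varFinsetLeft]

theorem freeVarFinset_substVar_numeral (zero : L.Functions 0) (succ : L.Functions 1) (n : ℕ)
    {φ : Wf L} {x : ℕ} (h : φ.freeVarFinset = {x}) :
    (substVar φ x (numeral zero succ n)).freeVarFinset = ∅ := by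
  refine Finset.eq_empty_of_forall_notMem fun b hb => ?_
  obtain ⟨a, ha, hab⟩ := mem_freeVarFinset_subst _ φ hb
  rw [h, Finset.mem_singleton] at ha
  simp [ha, varFinset_numeral] at hab

end Wf

/-! ### Derived rules of the Hilbert calculus. -/

namespace Provable

variable {L : FirstOrder.Language.{u', v'}} {T : Set (Wf L)} {φ ψ χ : Wf L}

theorem weaken (φ : Wf L) (h : Provable T ψ) : Provable T (φ.imp ψ) :=
  mp (a1 ψ φ) h

theorem imp_mp (h₁ : Provable T (φ.imp (ψ.imp χ))) (h₂ : Provable T (φ.imp ψ)) :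
    Provable T (φ.imp χ) :=
  mp (mp (a2 φ ψ χ) h₁) h₂

theorem imp_trans (h₁ : Provable T (φ.imp ψ)) (h₂ : Provable T (ψ.imp χ)) :
    Provable T (φ.imp χ) :=
  imp_mp (weaken φ h₂) h₁

theorem imp_self (φ : Wf L) : Provable T (φ.imp φ) :=
  imp_mp (a1 φ (φ.imp φ)) (a1 φ φ)

theorem imp_swap (h : Provable T (φ.imp (ψ.imp χ))) : Provable T (ψ.imp (φ.imp χ)) :=
  imp_trans (a1 ψ φ) (mp (a2 φ ψ χ) h)

theorem efq (φ : Wf L) : Provable T (BoundedFormula.imp (⊥ : Wf L) φ) :=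
  imp_mp (imp_mp (weaken _ (a3 (⊥ : Wf L) φ)) (weaken _ (weaken _ (imp_self _)))) (a1 _ _)

theorem of_not_not (h : Provable T φ.not.not) : Provable T φ :=
  mp (mp (a3 φ.not φ) (weaken _ h)) (imp_self _)

/-- `φ ⊓ ψ` unfolds to ¬(φ → ¬ψ), and ¬φ would yield φ → ¬ψ. -/
theorem and_left (h : Provable T (φ ⊓ ψ : Wf L)) : Provable T φ := by
  have h₁ : Provable T (φ.not.imp (φ.imp ψ.not)) :=
    imp_trans (imp_self _) (mp (a2 φ ⊥ ψ.not) (weaken φ (efq ψ.not)))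
  exact of_not_not (imp_trans h₁ h)

theorem and_right (h : Provable T (φ ⊓ ψ : Wf L)) : Provable T ψ :=
  of_not_not (imp_trans (a1 ψ.not φ) h)

theorem and_intro (h₁ : Provable T φ) (h₂ : Provable T ψ) : Provable T (φ ⊓ ψ : Wf L) :=
  imp_mp (imp_mp (imp_self (φ.imp ψ.not)) (weaken _ h₁)) (weaken _ h₂)

/-- Leibniz's law for the template z = y, with z = `y + 1` chosen to differ from y, turns y = y into
t = y. -/
theorem equal_symm (y : ℕ) (t : L.Term ℕ) :
    Provable T (((vr y).equal t).imp (t.equal (vr y))) := by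
  have h := a7 (T := T) (y + 1) ((vr (y + 1)).equal (vr y)) (vr y) t
  simp only [substVar_equal, vr, Term.subst, if_true, Nat.ne_of_lt (Nat.lt_succ_self y),
    if_false] at h
  exact imp_mp h (weaken _ (a6 _))

end Provable

end DiagLemma

/-! ### The diagonal argument. -/

open DiagLemma DiagLemma.Provable in
theorem mainTheorem4 {L : FirstOrder.Language}
    (zero : L.Functions 0) (succ : L.Functions 1)
    (T : Set (DiagLemma.Wf L)) (gn : DiagLemma.Wf L ↪ ℕ)
    (x : ℕ) (D : ℕ → ℕ)
    (hD : DiagLemma.IsDiagonal zero succ gn x D)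
    (hrep : DiagLemma.Representable T zero succ D)
    (E : DiagLemma.Wf L) (hE : E.freeVarFinset = {x}) :
    ∃ C : DiagLemma.Wf L, C.freeVarFinset = ∅ ∧
      DiagLemma.Provable T
        (C.iff (DiagLemma.substVar E x (DiagLemma.quote zero succ gn C))) := by
  obtain ⟨δ, hδ⟩ := hrep
  obtain ⟨y, hy⟩ : ∃ y, x ≠ y := ⟨x + 1, by omega⟩
  -- The guard x = x forces x to occur free even if δ ignores its first argument; `IsDiagonal` needs
  -- the free variables to be exactly {x}.
  let B : Wf L := BoundedFormula.imp ((vr x).equal (vr x))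
    (allVar y (BoundedFormula.imp (δ.subst ![vr x, vr y]) (substVar E x (vr y))))
  have hB : B.freeVarFinset = {x} := by
    refine Finset.Subset.antisymm (fun z hz => ?_) (fun z hz => Finset.mem_union_left _ ?_)
    · rcases Finset.mem_union.1 hz with hz | hz
      · rwa [freeVarFinset_vr_equal] at hz
      · obtain ⟨hz, hzy⟩ := mem_freeVarFinset_allVar hz
        rcases Finset.mem_union.1 hz with hz | hz
        · obtain ⟨i, -, hi⟩ := mem_freeVarFinset_subst _ δ hz
          fin_cases i <;> simp [Term.varFinset, hzy] at hi
          simpa using hi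
        · obtain ⟨a, ha, haz⟩ := mem_freeVarFinset_subst _ E hz
          rw [hE, Finset.mem_singleton] at ha
          simp [ha, Term.varFinset, hzy] at haz
    · rwa [freeVarFinset_vr_equal]
  let b : L.Term ℕ := quote zero succ gn B
  let C : Wf L := substVar B x b
  let q : L.Term ℕ := quote zero succ gn C
  have hq : numeral zero succ (D (gn B)) = q := congrArg (numeral zero succ) (hD B hB)
  have hbs (f : ℕ → L.Term ℕ) : b.subst f = b := numeral_subst_self zero succ _ f
  have hqs (f : ℕ → L.Term ℕ) : q.subst f = q := numeral_subst_self zero succ _ f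
  have hC : C = BoundedFormula.imp (b.equal b)
      (allVar y (BoundedFormula.imp (δ.subst ![b, vr y]) (substVar E x (vr y)))) := by
    change substVar (BoundedFormula.imp _ _) x (numeral zero succ _) = _
    rw [substVar_imp, substVar_allVar zero succ _ hy, substVar_imp, substVar_equal,
      substVar_subst_pair, substVar_substVar hE]
    simp [Term.subst, hy.symm, b, quote]
  -- Needed for two terms: q itself and the variable y.
  have hδt (t : L.Term ℕ) : Provable T (BoundedFormula.iff (δ.subst ![b, t]) (t.equal q)) := by
    have h := mp (a4 0 _ t) (hδ (gn B))
    rw [substVar_iff, substVar_subst_pair, substVar_equal, hq, hqs,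
      show numeral zero succ (gn B) = b from rfl, hbs] at h
    simpa only [vr, Term.subst, if_true] using h
  have hCE : Provable T (BoundedFormula.imp C (substVar E x q)) := by
    have h := a4 (T := T) y (BoundedFormula.imp (δ.subst ![b, vr y]) (substVar E x (vr y))) q
    rw [substVar_imp, substVar_subst_pair, substVar_substVar hE, hbs] at h
    simp only [Term.subst, if_true] at h
    have hself : Provable T (δ.subst ![b, q]) := mp (and_right (hδt q)) (a6 q)
    rw [hC]
    -- The guard b = b is discharged by reflexivity.
    exact imp_mp (imp_trans (imp_mp (imp_self _) (weaken _ (a6 b))) h) (weaken _ hself)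
  have hEC : Provable T (BoundedFormula.imp (substVar E x q) C) := by
    -- The chain is δ(b,y) → y = q → q = y → (E(q) → E(y)), with premises then swapped.
    have hy' : Provable T (BoundedFormula.imp (substVar E x q)
        (BoundedFormula.imp (δ.subst ![b, vr y]) (substVar E x (vr y)))) :=
      imp_swap (imp_trans (imp_trans (and_left (hδt (vr y))) (equal_symm y q))
        (a7 x E q (vr y)))
    -- E(q) is closed, which meets the side condition of `a5`.
    have hcl : y ∉ (substVar E x q).freeVarFinset := by
      rw [show (substVar E x q).freeVarFinset = ∅ from
        freeVarFinset_substVar_numeral zero succ _ hE]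
      exact Finset.notMem_empty y
    rw [hC]
    exact imp_trans (mp (a5 y _ _ hcl) (gen y hy')) (a1 _ _)
  exact ⟨C, freeVarFinset_substVar_numeral zero succ _ hB, and_intro hCE hEC⟩
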